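/- Let $k_0\subseteq k\subseteq\mathbb{C}$ be number fields such that $k/k_0$ is a quadratic extension whose nontrivial automorphism is complex conjugation. Let $L/k$ be a finite Galois extension with $L\subseteq\mathbb{C}$ and Galois group $G$, and assume that complex conjugation induces an automorphism $\alpha$ of $L$. Let $\xi$ be a $2$-cocycle of $G$ with values in $L^\times$ such that $\alpha(\xi_{\sigma,\rho})\,\xi_{\sigma,\rho}=1$ for all $\sigma,\rho\in G$, and let $B=(\xi,L/k,G)$ be the crossed product algebra: $B=\bigoplus_{\sigma\in G}L e_\sigma$ with $e_\sigma\lambda=\sigma(\lambda)e_\sigma$ for $\lambda\in L$, and $e_\sigma e_\rho=\xi_{\sigma,\rho}e_{\sigma\rho}$. Assume that $B$ is a division algebra. A unitary involution on $B$ (with respect to $k/k_0$) is an additive map $\tau:B\to B$ with $\tau(xy)=\tau(y)\tau(x)$ and $\tau(\tau(x))=x$ for all $x,y\in B$, whose fixed field in the centre $k$ of $B$ is $k_0$. It is positive (definite) if $\operatorname{Trd}_B(\tau(x)x)>0$ for all nonzero $x\in B$, with respect to the ordering that $k_0\subseteq\mathbb{R}$ inherits from $\mathbb{R}$, where $\operatorname{Trd}_B:B\to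 k$ denotes the reduced trace. Then $B$ carries a positive unitary involution $\tau$ with $\tau|_L=\alpha$ if and only if $\alpha\circ\sigma=\sigma\circ\alpha$ for all $\sigma\in G$. -/

import Mathlib

open scoped TensorProduct

universe u v w

noncomputable section

namespace CrossedProd

section Construction

variable (k : Type u) (L : Type v) [Field k] [Field L] [Algebra k L]

/-- `ξ` is a (multiplicative) `2`-cocycle of `Gal(L/k)` with values in `Lˣ`, for the natural action:
`ξ(gh, j) ξ(g, h) = g(ξ(h, j)) ξ(g, hj)` for all `g, h, j`. -/
def IsTwoCocycle (ξ : Gal(L/k) × Gal(L/k) → Lˣ) : Prop :=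
  groupCohomology.IsMulCocycle₂ ξ

/-- The crossed product algebra `(ξ, L/k, G)`, with `G = Gal(L/k)`, as a set: the element
`∑ σ, x_σ e_σ` of the left `L`-vector space with basis `(e_σ)` indexed by `G` is given by
its coefficients `x_σ`. Here `ξ` is a `2`-cocycle of `G` with values in `Lˣ`, not
assumed to be normalized. -/
structure CrossedProduct (ξ : Gal(L/k) × Gal(L/k) → Lˣ) (hξ : IsTwoCocycle k L ξ) : Type v where
  coeff : Gal(L/k) → L

variable {k L} {ξ : Gal(L/k) × Gal(L/k) → Lˣ} {hξ : IsTwoCocycle k L ξ}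

namespace CrossedProduct

/-- An element is the same as its family of coefficients. -/
def coeffEquiv : CrossedProduct k L ξ hξ ≃ (Gal(L/k) → L) where
  toFun := coeff
  invFun := mk
  left_inv _ := rfl
  right_inv _ := rfl

/-- Coefficientwise addition. -/
instance : AddCommGroup (CrossedProduct k L ξ hξ) := coeffEquiv.addCommGroup

/-- The left `L`-vector space structure `a (∑ σ, x_σ e_σ) = ∑ σ, (a x_σ) e_σ`. -/
instance : Module L (CrossedProduct k L ξ hξ) := coeffEquiv.module L

instance : Module k (CrossedProduct k L ξ hξ) := coeffEquiv.module k

open Classical in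
/-- The identity element is `ξ(1,1)⁻¹ e_1`. -/
instance : One (CrossedProduct k L ξ hξ) where
  one := ⟨fun g => if g = 1 then (((ξ (1, 1))⁻¹ : Lˣ) : L) else 0⟩

@[ext] theorem ext {x y : CrossedProduct k L ξ hξ} (h : ∀ g, x.coeff g = y.coeff g) : x = y :=
  coeffEquiv.injective (funext h)

theorem add_apply (x y : CrossedProduct k L ξ hξ) (g : Gal(L/k)) :
    (x + y).coeff g = x.coeff g + y.coeff g := rfl

theorem zero_apply (g : Gal(L/k)) : (0 : CrossedProduct k L ξ hξ).coeff g = 0 := rfl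

theorem smul_apply (a : L) (x : CrossedProduct k L ξ hξ) (g : Gal(L/k)) :
    (a • x).coeff g = a * x.coeff g := rfl

theorem ksmul_apply (a : k) (x : CrossedProduct k L ξ hξ) (g : Gal(L/k)) :
    (a • x).coeff g = a • x.coeff g := rfl

open Classical in
theorem one_apply (g : Gal(L/k)) : (1 : CrossedProduct k L ξ hξ).coeff g =
    if g = 1 then (((ξ (1, 1))⁻¹ : Lˣ) : L) else 0 := rfl

theorem cocycle_coe (hξ : IsTwoCocycle k L ξ) (g h j : Gal(L/k)) :
    (ξ (g * h, j) : L) * ξ (g, h) = g (ξ (h, j) : L) * ξ (g, h * j) := by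
  have := congrArg (Units.val) (hξ g h j)
  simpa using this

section Mul

variable [FiniteDimensional k L]

/-- The multiplication, that is, the biadditive extension of
`(a e_σ) (b e_ρ) = a σ(b) ξ(σ, ρ) e_{σρ}`. -/
instance : Mul (CrossedProduct k L ξ hξ) where
  mul x y := ⟨fun g => ∑ h : Gal(L/k), x.coeff h * h (y.coeff (h⁻¹ * g)) * (ξ (h, h⁻¹ * g) : L)⟩

theorem mul_apply (x y : CrossedProduct k L ξ hξ) (g : Gal(L/k)) :
    (x * y).coeff g =
      ∑ h : Gal(L/k), x.coeff h * h (y.coeff (h⁻¹ * g)) * (ξ (h, h⁻¹ * g) : L) := rfl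

theorem mul_assoc' (x y z : CrossedProduct k L ξ hξ) : x * y * z = x * (y * z) := by
  ext g
  simp only [mul_apply, map_sum, map_mul, Finset.sum_mul, Finset.mul_sum]
  rw [Finset.sum_comm]
  refine Finset.sum_congr rfl fun j _ => ?_
  refine Fintype.sum_equiv (Equiv.mulLeft j⁻¹) _ _ fun h => ?_
  have hc := cocycle_coe hξ j (j⁻¹ * h) (h⁻¹ * g)
  have e1 : j * (j⁻¹ * h) = h := by group
  have e2 : (j⁻¹ * h) * (h⁻¹ * g) = j⁻¹ * g := by group
  have e3 : (j⁻¹ * h)⁻¹ * (j⁻¹ * g) = h⁻¹ * g := by group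
  have e4 : ∀ t : L, j ((j⁻¹ * h) t) = h t := fun t => by
    rw [← AlgEquiv.mul_apply, e1]
  rw [e1, e2] at hc
  simp only [Equiv.coe_mulLeft, e3, e4]
  linear_combination (x.coeff j * j (y.coeff (j⁻¹ * h)) * h (z.coeff (h⁻¹ * g))) * hc

theorem one_mul' (x : CrossedProduct k L ξ hξ) : 1 * x = x := by
  ext g
  rw [mul_apply, Finset.sum_eq_single (1 : Gal(L/k))]
  · rw [one_apply, if_pos rfl, inv_one, one_mul, groupCohomology.map_one_fst_of_isMulCocycle₂ hξ g,
      AlgEquiv.one_apply]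
    rw [mul_right_comm, Units.inv_mul, one_mul]
  · intro h _ hh
    rw [one_apply, if_neg hh, zero_mul, zero_mul]
  · simp

theorem mul_one' (x : CrossedProduct k L ξ hξ) : x * 1 = x := by
  ext g
  rw [mul_apply, Finset.sum_eq_single g]
  · have h1 : (ξ (g, 1) : L) = g (ξ (1, 1) : L) := by
      rw [groupCohomology.map_one_snd_of_isMulCocycle₂ hξ]; simp
    rw [one_apply, inv_mul_cancel, if_pos rfl, h1, mul_assoc, ← map_mul, Units.inv_mul, map_one,
      mul_one]
  · intro h _ hh
    have : h⁻¹ * g ≠ 1 := fun H => hh (inv_mul_eq_one.mp H)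
    rw [one_apply, if_neg this, map_zero, mul_zero, zero_mul]
  · simp

instance : Ring (CrossedProduct k L ξ hξ) where
  __ := (inferInstance : AddCommGroup (CrossedProduct k L ξ hξ))
  mul_assoc := mul_assoc'
  one_mul := one_mul'
  mul_one := mul_one'
  zero_mul x := by ext g; simp [mul_apply, zero_apply]
  mul_zero x := by ext g; simp [mul_apply, zero_apply]
  left_distrib x y z := by
    ext g; simp [mul_apply, add_apply, mul_add, add_mul, Finset.sum_add_distrib]
  right_distrib x y z := by
    ext g; simp [mul_apply, add_apply, add_mul, Finset.sum_add_distrib]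

theorem smul_mul' (a : L) (x y : CrossedProduct k L ξ hξ) : a • x * y = a • (x * y) := by
  ext g
  simp only [mul_apply, smul_apply, Finset.mul_sum, mul_assoc]

instance : Algebra k (CrossedProduct k L ξ hξ) :=
  Algebra.ofModule
    (fun r x y => by
      ext g
      simp only [mul_apply, ksmul_apply, Finset.smul_sum, smul_mul_assoc])
    (fun r x y => by
      ext g
      simp only [mul_apply, ksmul_apply, Finset.smul_sum, smul_mul_assoc, mul_smul_comm,
        map_smul])

/-- The embedding of `L` as a subfield of the crossed product, `a ↦ a · 1`. -/
def ofField : L →ₐ[k] CrossedProduct k L ξ hξ where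
  toFun a := a • 1
  map_one' := one_smul _ _
  map_mul' a b := by rw [smul_mul', one_mul, mul_smul]
  map_zero' := zero_smul _ _
  map_add' a b := add_smul _ _ _
  commutes' r := by
    ext g
    simp only [Algebra.algebraMap_eq_smul_one, smul_apply, ksmul_apply, Algebra.smul_mul_assoc,
      one_mul]

end Mul

end CrossedProduct

end Construction

/-- `t` is the trace of the matrix of `b ⊗ 1` under some isomorphism `K ⊗_k B ≅ M_n(K)`,
for some splitting field `K` of the `k`-algebra `B`. -/
def IsReducedTrace (k : Type u) (B : Type v) [Field k] [Ring B] [Algebra k B] (b : B) (t : k) :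
    Prop :=
  ∃ (K : Type u) (_ : Field K) (_ : Algebra k K) (n : ℕ)
    (e : K ⊗[k] B ≃ₐ[K] Matrix (Fin n) (Fin n) K),
    algebraMap k K t = (e ((1 : K) ⊗ₜ[k] b)).trace

open Classical in
/-- The reduced trace `Trd_B : B → k` of a central simple `k`-algebra `B`. (For such `B`, there is
exactly one `t` with `IsReducedTrace k B b t`, independently of the splitting field and of
the isomorphism. For an algebra that is not central simple the value carries no meaning.) -/
def reducedTrace (k : Type u) (B : Type v) [Field k] [Ring B] [Algebra k B] (b : B) : k :=
  if h : ∃ t : k, IsReducedTrace k B b t then h.choose else 0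

/-- `τ` is a unitary `k/k₀`-involution on the central `k`-algebra `B`: an additive,
antimultiplicative map of order at most two, whose fixed field inside the centre `k` is `k₀`.
(It is meant for `k/k₀` quadratic; then `τ` restricts to the nontrivial automorphism
of `k/k₀`.) -/
structure IsUnitaryInvolution (k₀ : Type w) (k : Type u) {B : Type v} [Field k₀] [Field k]
    [Algebra k₀ k] [Ring B] [Algebra k B] (τ : B → B) : Prop where
  map_add : ∀ x y, τ (x + y) = τ x + τ y
  map_mul : ∀ x y, τ (x * y) = τ y * τ x
  involutive : ∀ x, τ (τ x) = x
  fixed_iff : ∀ c : k, τ (algebraMap k B c) = algebraMap k B c ↔ c ∈ Set.range (algebraMap k₀ k)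

/-- Positivity of an involution `τ` on a central simple algebra `B` over a field `k` of complex
numbers: the involution trace form `x ↦ Trd_B (τ(x) x)` is positive definite, i.e.
`Trd_B (τ(x) x)` is a positive real number for all `x ≠ 0`. -/
def IsPositiveInvolution (k : Type u) {B : Type v} [Field k] [Algebra k ℂ] [Ring B] [Algebra k B]
    (τ : B → B) : Prop :=
  ∀ x : B, x ≠ 0 →
    (algebraMap k ℂ (reducedTrace k B (τ x * x))).im = 0 ∧
      0 < (algebraMap k ℂ (reducedTrace k B (τ x * x))).re

end CrossedProd

end

/-!
A unitary involution extending `α` is `τ (∑ x_σ e_σ) = ∑ e_σ⁻¹ α(x_σ)`, which is antimultiplicative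
as soon as `α` commutes with `G`. Its trace form is `Trd (τ(x) x) = ∑_σ Tr_{L/k} (α(x_σ) x_σ)`,
where `Tr_{L/k} (α(z) z) = ∑_σ conj ((α⁻¹ σ α)(z)) σ(z)` for `z ∈ L`. If `α` commutes with `G`, this
is a sum of squared absolute values, so `τ` is positive.

Conversely, the form of any positive involution extending `α` restricts to `Tr_{L/k} (α(z) z)` on
`L`. Because `k` is not real, it is dense in `ℂ`, so the families of conjugates `(σ(z))_σ` are dense
in `ℂ^G` by Dedekind's independence of characters. Hence `∑_σ conj (v (α⁻¹ σ α)) v σ` has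
nonnegative real part for all `v ∈ ℂ^G`, which forces the permutation `σ ↦ α⁻¹ σ α` to be trivial.
-/

namespace CrossedProd

section ReducedTrace

theorem trace_algEquiv_apply {K m n : Type*} [Field K] [Fintype m] [DecidableEq m] [Fintype n]
    [DecidableEq n] (f : Matrix m m K ≃ₐ[K] Matrix n n K) (A : Matrix m m K) :
    (f A).trace = A.trace := by
  obtain ⟨T, hT⟩ :=
    (Matrix.toLinAlgEquiv'.symm.trans (f.trans Matrix.toLinAlgEquiv')).eq_linearEquivConjAlgEquiv
  have hconj : (f A).toLin' = T.conj A.toLin' := by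
    simpa [Matrix.toLinAlgEquiv', LinearMap.toMatrixAlgEquiv'] using! congr($hT A.toLin')
  rw [← Matrix.trace_toLin'_eq, hconj, LinearMap.trace_conj', Matrix.trace_toLin'_eq]

theorem exists_field_algHom_algHom (k : Type u) (K : Type v) (K' : Type w) [Field k] [Field K]
    [Field K'] [Algebra k K] [Algebra k K'] :
    ∃ (Ω : Type (max v w)) (_ : Field Ω) (_ : Algebra k Ω),
      Nonempty (K →ₐ[k] Ω) ∧ Nonempty (K' →ₐ[k] Ω) := by
  obtain ⟨M, _⟩ := Ideal.exists_maximal (K ⊗[k] K')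
  exact ⟨_, Ideal.Quotient.field M, inferInstance,
    ⟨(Ideal.Quotient.mkₐ k M).comp Algebra.TensorProduct.includeLeft⟩,
    ⟨(Ideal.Quotient.mkₐ k M).comp Algebra.TensorProduct.includeRight⟩⟩

theorem exists_algEquiv_matrix_of_isScalarTower {k K Ω B n : Type*} [Field k] [Field K] [Field Ω]
    [Ring B] [Algebra k K] [Algebra k Ω] [Algebra K Ω] [IsScalarTower k K Ω] [Algebra k B]
    [Fintype n] [DecidableEq n] (e : K ⊗[k] B ≃ₐ[K] Matrix n n K) :
    ∃ e' : Ω ⊗[k] B ≃ₐ[Ω] Matrix n n Ω, ∀ b, e' (1 ⊗ₜ b) = (e (1 ⊗ₜ b)).map (algebraMap K Ω) := by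
  let m : Ω ⊗[K] Matrix n n K ≃ₐ[Ω] Matrix n n Ω :=
    AlgEquiv.ofRingEquiv (f := (matrixEquivTensor n K Ω).symm.toRingEquiv) fun a => by
      ext i j
      simp [Matrix.algebraMap_matrix_apply, Matrix.one_apply]
  let f : Ω ⊗[k] B ≃ₗ[Ω] Matrix n n Ω :=
    (TensorProduct.AlgebraTensorModule.cancelBaseChange k K Ω Ω B).symm ≪≫ₗ
      e.toLinearEquiv.baseChange K Ω _ _ ≪≫ₗ m.toLinearEquiv
  have hf (a : Ω) (b : B) : f (a ⊗ₜ b) = a • (e (1 ⊗ₜ b)).map (algebraMap K Ω) := by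
    ext i j
    simp [f, m]
  have hf_mul (a a' : Ω) (b b' : B) :
      f ((a * a') ⊗ₜ (b * b')) = f (a ⊗ₜ b) * f (a' ⊗ₜ b') := by
    have he : e (1 ⊗ₜ (b * b')) = e (1 ⊗ₜ b) * e (1 ⊗ₜ b') := by
      rw [← map_mul, Algebra.TensorProduct.tmul_mul_tmul, one_mul]
    rw [hf, hf, hf, he, Matrix.map_mul, smul_mul_smul_comm]
  have hf_one : f (1 ⊗ₜ 1) = 1 := by
    rw [hf, ← Algebra.TensorProduct.one_def, map_one, one_smul,
      Matrix.map_one _ (map_zero _) (map_one _)]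
  exact ⟨Algebra.TensorProduct.algEquivOfLinearEquivTensorProduct f hf_mul hf_one,
    fun b => (hf 1 b).trans (one_smul _ _)⟩

theorem IsReducedTrace.unique {k : Type u} {B : Type v} [Field k] [Ring B] [Algebra k B] {b : B}
    {t t' : k} (h : IsReducedTrace k B b t) (h' : IsReducedTrace k B b t') : t = t' := by
  obtain ⟨K, _, _, n, e, he⟩ := h
  obtain ⟨K', _, _, n', e', he'⟩ := h'
  obtain ⟨Ω, _, _, ⟨φ⟩, ⟨φ'⟩⟩ := exists_field_algHom_algHom k K K'
  let := φ.toRingHom.toAlgebra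
  let := φ'.toRingHom.toAlgebra
  have : IsScalarTower k K Ω := .of_algHom φ
  have : IsScalarTower k K' Ω := .of_algHom φ'
  obtain ⟨E, hE⟩ := exists_algEquiv_matrix_of_isScalarTower (Ω := Ω) e
  obtain ⟨E', hE'⟩ := exists_algEquiv_matrix_of_isScalarTower (Ω := Ω) e'
  apply (algebraMap k Ω).injective
  calc algebraMap k Ω t = (E (1 ⊗ₜ b)).trace := by
        rw [IsScalarTower.algebraMap_apply k K Ω, he, hE, AddMonoidHom.map_trace]
    _ = ((E.symm.trans E') (E (1 ⊗ₜ b))).trace := (trace_algEquiv_apply _ _).symm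
    _ = (E' (1 ⊗ₜ b)).trace := by rw [AlgEquiv.trans_apply, E.symm_apply_apply]
    _ = algebraMap k Ω t' := by
        rw [IsScalarTower.algebraMap_apply k K' Ω, he', hE', AddMonoidHom.map_trace]

theorem IsReducedTrace.reducedTrace_eq {k : Type u} {B : Type v} [Field k] [Ring B] [Algebra k B]
    {b : B} {t : k} (h : IsReducedTrace k B b t) : reducedTrace k B b = t := by
  have hex : ∃ t, IsReducedTrace k B b t := ⟨t, h⟩
  rw [reducedTrace, dif_pos hex]
  exact hex.choose_spec.unique h

end ReducedTrace

theorem algEquiv_apply_eq_self_iff {F A : Type*} [Field F] [Ring A] [IsDomain A] [Algebra F A]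
    (hprime : (Module.finrank F A).Prime) {f : A ≃ₐ[F] A} (hf : f ≠ 1) {x : A} :
    f x = x ↔ x ∈ Set.range (algebraMap F A) := by
  have := Subalgebra.isSimpleOrder_of_finrank_prime F A hprime
  have hbot : AlgHom.equalizer (f : A →ₐ[F] A) (AlgHom.id F A) = ⊥ :=
    (eq_bot_or_eq_top _).resolve_right fun htop => hf <| AlgEquiv.ext fun y =>
      congr($(AlgHom.equalizer_eq_top.mp htop) y)
  exact (SetLike.ext_iff.mp hbot x).trans Algebra.mem_bot

section GaloisConjugates

theorem span_range_galois_conjugates (k L F : Type*) [Field k] [Field L] [Field F] [Algebra k L]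
    [Algebra L F] [FiniteDimensional k L] :
    Submodule.span F (Set.range fun (z : L) (σ : Gal(L/k)) => algebraMap L F (σ z)) = ⊤ := by
  let χ (σ : Gal(L/k)) : L →* F := (algebraMap L F).toMonoidHom.comp (σ : L →* L)
  have hχ : Function.Injective χ := fun σ ρ h =>
    AlgEquiv.ext fun z => (algebraMap L F).injective congr($h z)
  exact span_flip_eq_top_iff_linearIndependent.mpr ((linearIndependent_monoidHom L F).comp χ hχ)

theorem span_subset_closure_of_denseRange {k R E : Type*} [CommSemiring k] [Semiring R]
    [TopologicalSpace R] [Algebra k R] [AddCommMonoid E] [TopologicalSpace E] [ContinuousAdd E]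
    [Module R E] [ContinuousSMul R E] [Module k E] [IsScalarTower k R E]
    (hk : DenseRange (algebraMap k R)) (W : Submodule k E) :
    (Submodule.span R (W : Set E) : Set E) ⊆ closure W := by
  intro v hv
  induction hv using Submodule.span_induction with
  | mem v hv => exact subset_closure hv
  | zero => exact subset_closure W.zero_mem
  | add v w _ _ hv hw =>
    exact map_mem_closure₂ continuous_add hv hw fun _ ha _ hb => W.add_mem ha hb
  | smul c v _ hv =>
    refine map_mem_closure₂ continuous_smul (hk c) hv ?_
    rintro _ ⟨a, rfl⟩ w hw
    rw [algebraMap_smul]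
    exact W.smul_mem a hw

theorem denseRange_galois_conjugates {k L F : Type*} [Field k] [Field L] [Field F]
    [TopologicalSpace F] [ContinuousAdd F] [ContinuousMul F] [Algebra k L] [Algebra k F]
    [Algebra L F] [IsScalarTower k L F] [FiniteDimensional k L]
    (hk : DenseRange (algebraMap k F)) :
    DenseRange fun (z : L) (σ : Gal(L/k)) => algebraMap L F (σ z) := by
  let φ : L →ₗ[k] (Gal(L/k) → F) :=
    LinearMap.pi fun σ => (IsScalarTower.toAlgHom k L F).toLinearMap ∘ₗ σ.toLinearMap
  intro v
  refine span_subset_closure_of_denseRange hk (LinearMap.range φ) ?_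
  rw [SetLike.mem_coe, LinearMap.coe_range]
  exact span_range_galois_conjugates k L F ▸ Submodule.mem_top

theorem denseRange_algebraMap_complex {K : Type*} [Field K] [Algebra K ℂ] {z : K}
    (hz : (algebraMap K ℂ z).im ≠ 0) : DenseRange (algebraMap K ℂ) := by
  let S := (algebraMap K ℂ).fieldRange.topologicalClosure
  have hzS : algebraMap K ℂ z ∈ S := Subfield.le_topologicalClosure _ ⟨z, rfl⟩
  rcases Complex.subfield_eq_of_closed (Subfield.isClosed_topologicalClosure _) with hS | hS
  · obtain ⟨r, hr⟩ : algebraMap K ℂ z ∈ Complex.ofRealHom.fieldRange := hS ▸ hzS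
    exact absurd (by simp [← hr]) hz
  · intro w
    rw [← RingHom.coe_fieldRange]
    exact hS.ge (Subfield.mem_top w)

end GaloisConjugates

section TraceForm

theorem eq_id_of_forall_sum_mul_nonneg {ι R : Type*} [Fintype ι] [CommRing R] [LinearOrder R]
    [IsStrictOrderedRing R] {s : ι → ι} (h : ∀ v : ι → R, 0 ≤ ∑ i, v (s i) * v i) : s = id := by
  classical
  funext i
  by_contra hi
  let v : ι → R := Pi.single i 2 - Pi.single (s i) 1
  have hv : ∑ j, v (s j) * v j = v (s i) * 2 - v (s (s i)) := by
    simp [v, mul_sub, Pi.single_apply]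
  have hsi : v (s i) = -1 := by simp [v, show s i ≠ i from hi]
  have hssi : -1 ≤ v (s (s i)) := by
    simp only [v, Pi.sub_apply, Pi.single_apply]
    split_ifs <;> norm_num
  linarith [h v]

variable {k L : Type*} [Field k] [Field L] [Algebra k L]

/-- The `k`-automorphism `α⁻¹ ∘ σ ∘ α` of `L`. Conjugation by `α` is only semilinear, which is why
`α` has to map `k` into itself. -/
noncomputable def galConj (α : L ≃+* L)
    (hα : ∀ c, α (algebraMap k L c) ∈ Set.range (algebraMap k L)) (σ : Gal(L/k)) : Gal(L/k) :=
  AlgEquiv.ofRingEquiv (f := (α.trans σ.toRingEquiv).trans α.symm) fun c => by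
    obtain ⟨d, hd⟩ := hα c
    simp [← hd, RingEquiv.symm_apply_eq]

theorem apply_galConj_apply {α : L ≃+* L}
    (hα : ∀ c, α (algebraMap k L c) ∈ Set.range (algebraMap k L)) (σ : Gal(L/k)) (z : L) :
    α (galConj α hα σ z) = σ (α z) :=
  α.apply_symm_apply _

variable [Algebra k ℂ] [Algebra L ℂ] [IsScalarTower k L ℂ] [FiniteDimensional k L] [IsGalois k L]

theorem algebraMap_trace_mul_eq_sum {α : L ≃+* L}
    (hαk : ∀ c, α (algebraMap k L c) ∈ Set.range (algebraMap k L))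
    (hα : ∀ z, algebraMap L ℂ (α z) = starRingEnd ℂ (algebraMap L ℂ z)) (z : L) :
    algebraMap k ℂ (Algebra.trace k L (α z * z)) =
      ∑ σ : Gal(L/k), starRingEnd ℂ (algebraMap L ℂ (galConj α hαk σ z)) *
        algebraMap L ℂ (σ z) := by
  rw [IsScalarTower.algebraMap_apply k L ℂ, trace_eq_sum_automorphisms, map_sum]
  simp only [← hα, apply_galConj_apply, map_mul]

theorem apply_galois_comm_of_trace_nonneg (hk : DenseRange (algebraMap k ℂ)) {α : L ≃+* L}
    (hαk : ∀ c, α (algebraMap k L c) ∈ Set.range (algebraMap k L))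
    (hα : ∀ z, algebraMap L ℂ (α z) = starRingEnd ℂ (algebraMap L ℂ z))
    (hpos : ∀ z : L, 0 ≤ (algebraMap k ℂ (Algebra.trace k L (α z * z))).re)
    (σ : Gal(L/k)) (z : L) : α (σ z) = σ (α z) := by
  let F (v : Gal(L/k) → ℂ) : ℝ := (∑ σ, starRingEnd ℂ (v (galConj α hαk σ)) * v σ).re
  have hF : Continuous F := by fun_prop
  have hF_nonneg (v : Gal(L/k) → ℂ) : 0 ≤ F v := by
    refine (denseRange_galois_conjugates (L := L) hk).induction_on v
      (isClosed_le continuous_const hF) fun z => ?_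
    simpa only [F, ← algebraMap_trace_mul_eq_sum hαk hα] using hpos z
  have hid : galConj α hαk = id := eq_id_of_forall_sum_mul_nonneg fun v : Gal(L/k) → ℝ => by
    simpa [F] using hF_nonneg fun σ => (v σ : ℂ)
  rw [← apply_galConj_apply hαk, hid, id]

theorem algebraMap_trace_mul_eq_sum_normSq {α : L ≃+* L}
    (hα : ∀ z, algebraMap L ℂ (α z) = starRingEnd ℂ (algebraMap L ℂ z))
    (hcomm : ∀ (σ : Gal(L/k)) (z : L), α (σ z) = σ (α z)) (z : L) :
    algebraMap k ℂ (Algebra.trace k L (α z * z)) =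
      ((∑ σ : Gal(L/k), Complex.normSq (algebraMap L ℂ (σ z)) : ℝ) : ℂ) := by
  rw [IsScalarTower.algebraMap_apply k L ℂ, trace_eq_sum_automorphisms, map_sum, Complex.ofReal_sum]
  simp only [Complex.normSq_eq_conj_mul_self, ← hα, hcomm, map_mul]

end TraceForm

namespace CrossedProduct

open scoped Ring

section Presentation

variable {k : Type u} {L : Type v} [Field k] [Field L] [Algebra k L]
  {ξ : Gal(L/k) × Gal(L/k) → Lˣ} {hξ : IsTwoCocycle k L ξ}

theorem sum_apply {ι : Type*} (s : Finset ι) (x : ι → CrossedProduct k L ξ hξ) (g : Gal(L/k)) :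
    (∑ i ∈ s, x i).coeff g = ∑ i ∈ s, (x i).coeff g := by
  rw [← Finset.sum_apply]
  exact congrFun (map_sum (coeffEquiv.linearEquiv L) x s) g

open Classical in
/-- The element `e_σ` of the standard `L`-basis of the crossed product. -/
noncomputable def basisElem (hξ : IsTwoCocycle k L ξ) (σ : Gal(L/k)) : CrossedProduct k L ξ hξ :=
  ⟨Pi.single σ 1⟩

theorem basisElem_apply_self (σ : Gal(L/k)) : (basisElem hξ σ).coeff σ = 1 := by
  classical exact Pi.single_eq_same σ 1

theorem basisElem_apply_of_ne {σ g : Gal(L/k)} (h : g ≠ σ) : (basisElem hξ σ).coeff g = 0 := by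
  classical exact Pi.single_eq_of_ne h 1

variable [FiniteDimensional k L]

theorem ofField_mul (a : L) (x : CrossedProduct k L ξ hξ) : ofField a * x = a • x :=
  (smul_mul' a 1 x).trans (congrArg (a • ·) (one_mul x))

theorem sum_ofField_mul_basisElem (x : CrossedProduct k L ξ hξ) :
    ∑ σ, ofField (x.coeff σ) * basisElem hξ σ = x := by
  ext g
  simp only [sum_apply, ofField_mul, smul_apply]
  rw [Finset.sum_eq_single g (fun σ _ hσ => by rw [basisElem_apply_of_ne hσ.symm, mul_zero])
    (by simp), basisElem_apply_self, mul_one]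

theorem induction_on {p : CrossedProduct k L ξ hξ → Prop} (x : CrossedProduct k L ξ hξ)
    (zero : p 0) (add : ∀ x y, p x → p y → p (x + y))
    (term : ∀ a σ, p (ofField a * basisElem hξ σ)) : p x :=
  sum_ofField_mul_basisElem x ▸ Finset.sum_induction _ p add zero fun σ _ => term _ σ

theorem basisElem_mul_apply (σ g : Gal(L/k)) (x : CrossedProduct k L ξ hξ) :
    (basisElem hξ σ * x).coeff g = σ (x.coeff (σ⁻¹ * g)) * ξ (σ, σ⁻¹ * g) := by
  rw [mul_apply, Finset.sum_eq_single σ]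
  · rw [basisElem_apply_self, one_mul]
  · intro h _ hh
    rw [basisElem_apply_of_ne hh, zero_mul, zero_mul]
  · simp

theorem basisElem_mul_basisElem (σ ρ : Gal(L/k)) :
    basisElem hξ σ * basisElem hξ ρ = ofField (ξ (σ, ρ) : L) * basisElem hξ (σ * ρ) := by
  ext g
  rw [basisElem_mul_apply, ofField_mul, smul_apply]
  rcases eq_or_ne g (σ * ρ) with rfl | hg
  · rw [inv_mul_cancel_left, basisElem_apply_self, basisElem_apply_self, map_one, one_mul, mul_one]
  · have hg' : σ⁻¹ * g ≠ ρ := fun h => hg (eq_mul_of_inv_mul_eq h)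
    rw [basisElem_apply_of_ne hg, basisElem_apply_of_ne hg', map_zero, zero_mul, mul_zero]

theorem basisElem_one : basisElem hξ 1 = ofField (ξ (1, 1) : L) := by
  ext g
  rw [← mul_one (ofField _), ofField_mul, smul_apply, one_apply]
  split_ifs with hg
  · rw [hg, basisElem_apply_self, Units.mul_inv]
  · rw [basisElem_apply_of_ne hg, mul_zero]

theorem basisElem_mul_ofField (σ : Gal(L/k)) (a : L) :
    basisElem hξ σ * ofField a = ofField (σ a) * basisElem hξ σ := by
  rw [← mul_one (ofField a), ofField_mul, ofField_mul, ← mul_one (basisElem hξ σ), mul_assoc]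
  ext g
  rw [basisElem_mul_apply, smul_apply, basisElem_mul_apply, one_mul, smul_apply, map_mul, mul_assoc]

theorem ofField_mul_basisElem_mul (a b : L) (σ ρ : Gal(L/k)) :
    ofField a * basisElem hξ σ * (ofField b * basisElem hξ ρ) =
      ofField (a * σ b * ξ (σ, ρ)) * basisElem hξ (σ * ρ) := by
  rw [mul_assoc, ← mul_assoc (basisElem hξ σ), basisElem_mul_ofField, mul_assoc (ofField _),
    basisElem_mul_basisElem, ← mul_assoc, ← mul_assoc, ← map_mul, ← map_mul]

theorem isUnit_basisElem (σ : Gal(L/k)) : IsUnit (basisElem hξ σ) := by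
  have h (ρ ρ' : Gal(L/k)) (hρ : ρ * ρ' = 1) : IsUnit (basisElem hξ ρ * basisElem hξ ρ') := by
    rw [basisElem_mul_basisElem, hρ, basisElem_one, ← map_mul]
    exact ((ξ (ρ, ρ')).isUnit.mul (ξ (1, 1)).isUnit).map ofField
  rw [isUnit_iff_exists_and_exists]
  obtain ⟨b, hb⟩ := (h σ σ⁻¹ (mul_inv_cancel σ)).exists_right_inv
  obtain ⟨c, hc⟩ := (h σ⁻¹ σ (inv_mul_cancel σ)).exists_left_inv
  exact ⟨⟨_, (mul_assoc _ _ _).symm.trans hb⟩, ⟨_, (mul_assoc _ _ _).trans hc⟩⟩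

/-- The coefficient of an element at the identity. It differs from `x.coeff 1`, the coefficient at
`e_1`, because the cocycle is not normalized: `e_1 = ξ(1,1) · 1`. -/
noncomputable def scalarPart : CrossedProduct k L ξ hξ →+ L where
  toFun x := x.coeff 1 * ξ (1, 1)
  map_zero' := by rw [zero_apply, zero_mul]
  map_add' x y := by rw [add_apply, add_mul]

theorem scalarPart_apply (x : CrossedProduct k L ξ hξ) :
    scalarPart x = x.coeff 1 * ξ (1, 1) :=
  rfl

theorem scalarPart_ofField (a : L) : scalarPart (ofField a : CrossedProduct k L ξ hξ) = a := by
  rw [← mul_one (ofField a), ofField_mul, scalarPart_apply, smul_apply, one_apply,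
    if_pos rfl, mul_assoc, Units.inv_mul, mul_one]

theorem ofField_injective : Function.Injective (ofField : L →ₐ[k] CrossedProduct k L ξ hξ) :=
  Function.LeftInverse.injective scalarPart_ofField

theorem scalarPart_inverse_basisElem_mul (σ : Gal(L/k)) (x : CrossedProduct k L ξ hξ) :
    scalarPart ((basisElem hξ σ)⁻¹ʳ * x) = σ⁻¹ (x.coeff σ) := by
  obtain ⟨y, rfl⟩ : ∃ y, x = basisElem hξ σ * y :=
    ⟨_, (Ring.mul_inverse_cancel_left _ x (isUnit_basisElem σ)).symm⟩
  rw [Ring.inverse_mul_cancel_left _ _ (isUnit_basisElem σ), basisElem_mul_apply, inv_mul_cancel,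
    groupCohomology.map_one_snd_of_isMulCocycle₂ hξ, scalarPart_apply]
  simp

end Presentation

section Splitting

variable {k : Type u} {L : Type v} [Field k] [Field L] [Algebra k L] [FiniteDimensional k L]
  {ξ : Gal(L/k) × Gal(L/k) → Lˣ} {hξ : IsTwoCocycle k L ξ}

theorem mul_ofField_apply (x : CrossedProduct k L ξ hξ) (a : L) (g : Gal(L/k)) :
    (x * ofField a).coeff g = x.coeff g * g a := by
  induction x using induction_on with
  | zero => simp [zero_apply]
  | add x y hx hy => rw [add_mul, add_apply, hx, hy, add_apply, add_mul]
  | term b σ =>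
  rw [mul_assoc, basisElem_mul_ofField, ofField_mul, ofField_mul, ofField_mul]
  simp only [smul_apply]
  rcases eq_or_ne g σ with rfl | hg
  · ring
  · simp [basisElem_apply_of_ne hg]

theorem scalarPart_mul_ofField (x : CrossedProduct k L ξ hξ) (a : L) :
    scalarPart (x * ofField a) = scalarPart x * a := by
  rw [scalarPart_apply, scalarPart_apply, mul_ofField_apply, AlgEquiv.one_apply, mul_right_comm]

theorem sum_basisElem_mul_ofField_scalarPart (x : CrossedProduct k L ξ hξ) :
    ∑ σ, basisElem hξ σ * ofField (scalarPart ((basisElem hξ σ)⁻¹ʳ * x)) = x := by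
  conv_rhs => rw [← sum_ofField_mul_basisElem x]
  refine Finset.sum_congr rfl fun σ _ => ?_
  rw [scalarPart_inverse_basisElem_mul, basisElem_mul_ofField, ← AlgEquiv.mul_apply,
    mul_inv_cancel, AlgEquiv.one_apply]

theorem scalarPart_inverse_basisElem_mul_mul_basisElem (x : CrossedProduct k L ξ hξ)
    (σ : Gal(L/k)) :
    scalarPart ((basisElem hξ σ)⁻¹ʳ * (x * basisElem hξ σ)) = σ⁻¹ (scalarPart x) := by
  rw [scalarPart_inverse_basisElem_mul, mul_apply, Finset.sum_eq_single 1]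
  · rw [inv_one, one_mul, basisElem_apply_self, map_one, mul_one,
      groupCohomology.map_one_fst_of_isMulCocycle₂ hξ, scalarPart_apply]
  · intro ρ _ hρ
    rw [basisElem_apply_of_ne (by simpa using hρ), map_zero, mul_zero, zero_mul]
  · simp

theorem finrank_eq [IsGalois k L] :
    Module.finrank k (CrossedProduct k L ξ hξ) = Module.finrank k L ^ 2 := by
  rw [(coeffEquiv.linearEquiv k : CrossedProduct k L ξ hξ ≃ₗ[k] _).finrank_eq,
    Module.finrank_pi_fintype, Finset.sum_const, Finset.card_univ, ← Nat.card_eq_fintype_card,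
    IsGalois.card_aut_eq_finrank, smul_eq_mul, sq]

variable [DecidableEq Gal(L/k)]

theorem scalarPart_inverse_basisElem_mul_ofField_mul_basisElem (a : L) (σ ρ : Gal(L/k)) :
    scalarPart ((basisElem hξ σ)⁻¹ʳ * (ofField a * basisElem hξ ρ)) =
      Matrix.diagonal (fun σ : Gal(L/k) => σ⁻¹ a) σ ρ := by
  rw [scalarPart_inverse_basisElem_mul, ofField_mul, smul_apply, Matrix.diagonal_apply]
  split_ifs with h
  · rw [h, basisElem_apply_self, mul_one]
  · rw [basisElem_apply_of_ne h, mul_zero, map_zero]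

/-- The action of the crossed product on itself by left multiplication, as matrices over `L` with
respect to the basis `(e_σ)` of the right `L`-vector space underlying the crossed product:
`x e_ρ = ∑ σ, e_σ m_{σ,ρ}`. -/
noncomputable def leftMulMatrix (hξ : IsTwoCocycle k L ξ) :
    CrossedProduct k L ξ hξ →ₐ[k] Matrix Gal(L/k) Gal(L/k) L where
  toFun x := .of fun σ ρ => scalarPart ((basisElem hξ σ)⁻¹ʳ * (x * basisElem hξ ρ))
  map_zero' := by ext; simp
  map_add' x y := by ext; simp [add_mul, mul_add]
  map_one' := by
    ext σ ρ
    rw [← map_one ofField, Matrix.of_apply, scalarPart_inverse_basisElem_mul_ofField_mul_basisElem]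
    simp
  map_mul' x y := by
    ext σ ρ
    simp only [Matrix.of_apply, Matrix.mul_apply, ← scalarPart_mul_ofField]
    rw [← map_sum]
    simp only [mul_assoc, ← Finset.mul_sum, sum_basisElem_mul_ofField_scalarPart]
  commutes' c := by
    ext σ ρ
    rw [← ofField.commutes, Matrix.of_apply, scalarPart_inverse_basisElem_mul_ofField_mul_basisElem]
    simp only [AlgEquiv.commutes]
    rfl

theorem leftMulMatrix_apply (x : CrossedProduct k L ξ hξ) (σ ρ : Gal(L/k)) :
    leftMulMatrix hξ x σ ρ = scalarPart ((basisElem hξ σ)⁻¹ʳ * (x * basisElem hξ ρ)) :=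
  rfl

theorem leftMulMatrix_ofField (a : L) :
    leftMulMatrix hξ (ofField a) = Matrix.diagonal fun σ => σ⁻¹ a := by
  ext
  exact scalarPart_inverse_basisElem_mul_ofField_mul_basisElem _ _ _

theorem leftMulMatrix_basisElem_apply (σ τ ρ : Gal(L/k)) :
    leftMulMatrix hξ (basisElem hξ τ) σ ρ = if σ = τ * ρ then σ⁻¹ (ξ (τ, ρ) : L) else 0 := by
  rw [leftMulMatrix_apply, basisElem_mul_basisElem,
    scalarPart_inverse_basisElem_mul_ofField_mul_basisElem, Matrix.diagonal_apply]

theorem trace_leftMulMatrix [IsGalois k L] (x : CrossedProduct k L ξ hξ) :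
    (leftMulMatrix hξ x).trace = algebraMap k L (Algebra.trace k L (scalarPart x)) := by
  simp only [Matrix.trace, Matrix.diag_apply, leftMulMatrix_apply,
    scalarPart_inverse_basisElem_mul_mul_basisElem]
  rw [trace_eq_sum_automorphisms, ← Equiv.sum_comp (Equiv.inv Gal(L/k))]
  rfl

/-- The `L`-linear extension of `leftMulMatrix`. -/
noncomputable def splittingHom (hξ : IsTwoCocycle k L ξ) :
    L ⊗[k] CrossedProduct k L ξ hξ →ₐ[L] Matrix Gal(L/k) Gal(L/k) L :=
  Algebra.TensorProduct.lift (Algebra.ofId L _) (leftMulMatrix hξ)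
    fun _ _ => Algebra.commutes _ _

theorem splittingHom_one_tmul (x : CrossedProduct k L ξ hξ) :
    splittingHom hξ (1 ⊗ₜ x) = leftMulMatrix hξ x := by
  refine (Algebra.TensorProduct.lift_tmul _ _ _ _ _).trans ?_
  rw [map_one, one_mul]

theorem diagonal_mem_range_splittingHom (d : Gal(L/k) → L) :
    Matrix.diagonal d ∈ (splittingHom hξ).range := by
  let D := Matrix.diagonalLinearMap Gal(L/k) L L ∘ₗ LinearMap.funLeft L L Inv.inv
  have hD : (⊤ : Submodule L (Gal(L/k) → L)) ≤
      (Subalgebra.toSubmodule (splittingHom hξ).range).comap D := by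
    rw [← span_range_galois_conjugates k L L, Submodule.span_le]
    rintro _ ⟨z, rfl⟩
    exact ⟨1 ⊗ₜ ofField z, (splittingHom_one_tmul _).trans (leftMulMatrix_ofField z)⟩
  have hd : D (fun σ => d σ⁻¹) = Matrix.diagonal d :=
    congrArg Matrix.diagonal (funext fun σ => congrArg d (inv_inv σ))
  exact hd ▸ hD Submodule.mem_top

theorem splittingHom_surjective (hξ : IsTwoCocycle k L ξ) :
    Function.Surjective (splittingHom hξ) := by
  have hsingle (σ ρ : Gal(L/k)) (a : L) : Matrix.single σ ρ a ∈ (splittingHom hξ).range := by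
    let c : L := σ⁻¹ (ξ (σ * ρ⁻¹, ρ) : L)
    have heq : Matrix.single σ ρ a = Matrix.diagonal (Pi.single σ (a * c⁻¹)) *
        splittingHom hξ (1 ⊗ₜ basisElem hξ (σ * ρ⁻¹)) := by
      ext i j
      rw [Matrix.diagonal_mul, splittingHom_one_tmul, leftMulMatrix_basisElem_apply]
      rcases eq_or_ne σ i with rfl | hi
      · rcases eq_or_ne ρ j with rfl | hj
        · simp [c]
        · simp [hj, mul_assoc, eq_comm (a := σ), inv_mul_eq_one]
      · simp [hi, hi.symm]
    exact heq ▸ mul_mem (diagonal_mem_range_splittingHom _) ⟨_, rfl⟩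
  intro M
  change M ∈ (splittingHom hξ).range
  rw [Matrix.matrix_eq_sum_single M]
  exact sum_mem fun _ _ => sum_mem fun _ _ => hsingle _ _ _

theorem splittingHom_bijective [IsGalois k L] (hξ : IsTwoCocycle k L ξ) :
    Function.Bijective (splittingHom hξ) := by
  have hs := splittingHom_surjective hξ
  have : FiniteDimensional k (CrossedProduct k L ξ hξ) :=
    Module.Finite.equiv (coeffEquiv.linearEquiv k).symm
  refine ⟨?_, hs⟩
  refine (LinearMap.injective_iff_surjective_of_finrank_eq_finrank
    (f := (splittingHom hξ).toLinearMap) ?_).mpr hs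
  rw [Module.finrank_baseChange, finrank_eq, Module.finrank_matrix, ← Nat.card_eq_fintype_card,
    IsGalois.card_aut_eq_finrank, Module.finrank_self, mul_one, sq]

end Splitting

section ReducedTrace

variable {k L : Type u} [Field k] [Field L] [Algebra k L] [FiniteDimensional k L] [IsGalois k L]
  {ξ : Gal(L/k) × Gal(L/k) → Lˣ} {hξ : IsTwoCocycle k L ξ}

theorem reducedTrace_eq (x : CrossedProduct k L ξ hξ) :
    reducedTrace k (CrossedProduct k L ξ hξ) x = Algebra.trace k L (scalarPart x) := by
  classical
  let f := Fintype.equivFin Gal(L/k)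
  let e := (AlgEquiv.ofBijective _ (splittingHom_bijective hξ)).trans (Matrix.reindexAlgEquiv L L f)
  refine IsReducedTrace.reducedTrace_eq ⟨L, inferInstance, inferInstance, _, e, ?_⟩
  have htrace : (e (1 ⊗ₜ x)).trace = (splittingHom hξ (1 ⊗ₜ x)).trace :=
    Equiv.sum_comp f.symm fun σ => splittingHom hξ (1 ⊗ₜ x) σ σ
  rw [htrace, splittingHom_one_tmul, trace_leftMulMatrix]

end ReducedTrace

section Conjugation

variable {k : Type u} {L : Type v} [Field k] [Field L] [Algebra k L] [FiniteDimensional k L]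
  {ξ : Gal(L/k) × Gal(L/k) → Lˣ} {hξ : IsTwoCocycle k L ξ} {α : L ≃+* L}

theorem ofField_mul_inverse_basisElem (σ : Gal(L/k)) (a : L) :
    ofField a * (basisElem hξ σ)⁻¹ʳ = (basisElem hξ σ)⁻¹ʳ * ofField (σ a) := by
  have hσ := isUnit_basisElem (hξ := hξ) σ
  rw [← Ring.inverse_mul_cancel_left _ (ofField a * _) hσ, ← mul_assoc (basisElem hξ σ),
    basisElem_mul_ofField, Ring.mul_inverse_cancel_right _ _ hσ]

theorem inverse_ofField {c : L} (hc : c ≠ 0) :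
    (ofField c : CrossedProduct k L ξ hξ)⁻¹ʳ = ofField c⁻¹ := by
  rw [← mul_one (ofField c)⁻¹ʳ, Ring.inverse_mul_eq_iff_eq_mul _ _ _ (hc.isUnit.map ofField),
    ← map_mul, mul_inv_cancel₀ hc, map_one]

/-- The map `∑ σ, x_σ e_σ ↦ ∑ σ, e_σ⁻¹ α(x_σ)`, which is the candidate for an involution
extending `α`: it sends the `e_σ` to their inverses. -/
noncomputable def conjugation (α : L ≃+* L) :
    CrossedProduct k L ξ hξ →+ CrossedProduct k L ξ hξ where
  toFun x := ∑ σ, (basisElem hξ σ)⁻¹ʳ * ofField (α (x.coeff σ))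
  map_zero' := by simp [zero_apply]
  map_add' x y := by simp [add_apply, mul_add, Finset.sum_add_distrib]

theorem conjugation_apply (x : CrossedProduct k L ξ hξ) :
    conjugation α x = ∑ σ, (basisElem hξ σ)⁻¹ʳ * ofField (α (x.coeff σ)) :=
  rfl

theorem conjugation_ofField_mul_basisElem (a : L) (σ : Gal(L/k)) :
    conjugation α (ofField a * basisElem hξ σ) = (basisElem hξ σ)⁻¹ʳ * ofField (α a) := by
  rw [conjugation_apply, Finset.sum_eq_single σ]
  · rw [ofField_mul, smul_apply, basisElem_apply_self, mul_one]
  · intro ρ _ hρ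
    rw [ofField_mul, smul_apply, basisElem_apply_of_ne hρ, mul_zero, map_zero, map_zero, mul_zero]
  · simp

theorem scalarPart_conjugation_mul_self (x : CrossedProduct k L ξ hξ) :
    scalarPart (conjugation α x * x) = ∑ σ : Gal(L/k), σ⁻¹ (α (x.coeff σ) * x.coeff σ) := by
  simp only [conjugation_apply, Finset.sum_mul, map_sum, mul_assoc,
    scalarPart_inverse_basisElem_mul, ofField_mul, smul_apply]

theorem conjugation_ofField (hunit : ∀ σ ρ, α (ξ (σ, ρ) : L) * (ξ (σ, ρ) : L) = 1) (a : L) :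
    conjugation α (ofField a : CrossedProduct k L ξ hξ) = ofField (α a) := by
  have hξ₁ : (ξ (1, 1) : L) ≠ 0 := Units.ne_zero _
  have ha : (ofField a : CrossedProduct k L ξ hξ) =
      ofField (a * (ξ (1, 1) : L)⁻¹) * basisElem hξ 1 := by
    rw [basisElem_one, ← map_mul, inv_mul_cancel_right₀ hξ₁]
  rw [ha, conjugation_ofField_mul_basisElem, basisElem_one, inverse_ofField hξ₁, ← map_mul,
    map_mul α, map_inv₀, eq_inv_of_mul_eq_one_left (hunit 1 1), inv_inv, mul_comm,
    mul_inv_cancel_right₀ hξ₁]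

theorem conjugation_mul (hunit : ∀ σ ρ, α (ξ (σ, ρ) : L) * (ξ (σ, ρ) : L) = 1)
    (hcomm : ∀ (σ : Gal(L/k)) (z : L), α (σ z) = σ (α z)) (x y : CrossedProduct k L ξ hξ) :
    conjugation α (x * y) = conjugation α y * conjugation α x := by
  induction x using induction_on with
  | zero => simp
  | add x x' hx hx' => rw [add_mul, map_add, map_add, mul_add, hx, hx']
  | term a σ =>
  induction y using induction_on with
  | zero => simp
  | add y y' hy hy' => rw [mul_add, map_add, map_add, add_mul, hy, hy']
  | term b ρ =>
  have hprod : (basisElem hξ ρ)⁻¹ʳ * (basisElem hξ σ)⁻¹ʳ =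
      (basisElem hξ (σ * ρ))⁻¹ʳ * ofField (ξ (σ, ρ) : L)⁻¹ := by
    rw [← Ring.inverse_mul (.inl (isUnit_basisElem σ)), basisElem_mul_basisElem,
      Ring.inverse_mul (.inr (isUnit_basisElem _)), inverse_ofField (Units.ne_zero _)]
  calc conjugation α (ofField a * basisElem hξ σ * (ofField b * basisElem hξ ρ))
      = (basisElem hξ (σ * ρ))⁻¹ʳ * ofField (α (a * σ b * ξ (σ, ρ))) := by
        rw [ofField_mul_basisElem_mul, conjugation_ofField_mul_basisElem]
    _ = (basisElem hξ (σ * ρ))⁻¹ʳ * ofField ((ξ (σ, ρ) : L)⁻¹ * (σ (α b) * α a)) := by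
        rw [map_mul α, map_mul α, hcomm, eq_inv_of_mul_eq_one_left (hunit σ ρ), mul_comm (_ * _),
          mul_comm (α a)]
    _ = (basisElem hξ ρ)⁻¹ʳ * ((basisElem hξ σ)⁻¹ʳ * ofField (σ (α b))) * ofField (α a) := by
        simp only [map_mul ofField, ← mul_assoc, hprod]
    _ = conjugation α (ofField b * basisElem hξ ρ) *
          conjugation α (ofField a * basisElem hξ σ) := by
        simp only [← ofField_mul_inverse_basisElem, conjugation_ofField_mul_basisElem, mul_assoc]

theorem conjugation_conjugation (hunit : ∀ σ ρ, α (ξ (σ, ρ) : L) * (ξ (σ, ρ) : L) = 1)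
    (hcomm : ∀ (σ : Gal(L/k)) (z : L), α (σ z) = σ (α z)) (hα : Function.Involutive α)
    (x : CrossedProduct k L ξ hξ) : conjugation α (conjugation α x) = x := by
  have hmul := conjugation_mul (hξ := hξ) hunit hcomm
  induction x using induction_on with
  | zero => simp
  | add x y hx hy => rw [map_add, map_add, hx, hy]
  | term a σ =>
  have hσ := isUnit_basisElem (hξ := hξ) σ
  have hτσ : conjugation α (basisElem hξ σ) = (basisElem hξ σ)⁻¹ʳ := by
    simpa using conjugation_ofField_mul_basisElem (α := α) (hξ := hξ) 1 σ
  have hτ1 : conjugation α (1 : CrossedProduct k L ξ hξ) = 1 := by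
    simpa using conjugation_ofField (hξ := hξ) hunit 1
  have hτσ' : conjugation α (basisElem hξ σ)⁻¹ʳ = basisElem hξ σ :=
    calc conjugation α (basisElem hξ σ)⁻¹ʳ
        = conjugation α (basisElem hξ σ * (basisElem hξ σ)⁻¹ʳ) * basisElem hξ σ := by
          rw [hmul, hτσ, Ring.inverse_mul_cancel_right _ _ hσ]
      _ = basisElem hξ σ := by rw [Ring.mul_inverse_cancel _ hσ, hτ1, one_mul]
  rw [conjugation_ofField_mul_basisElem, hmul, conjugation_ofField hunit, hα, hτσ']

theorem isUnitaryInvolution_conjugation {k₀ : Type w} [Field k₀] [Algebra k₀ k]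
    (hunit : ∀ σ ρ, α (ξ (σ, ρ) : L) * (ξ (σ, ρ) : L) = 1)
    (hcomm : ∀ (σ : Gal(L/k)) (z : L), α (σ z) = σ (α z)) (hα : Function.Involutive α)
    (hfix : ∀ c : k, α (algebraMap k L c) = algebraMap k L c ↔ c ∈ Set.range (algebraMap k₀ k)) :
    IsUnitaryInvolution k₀ k (conjugation α : CrossedProduct k L ξ hξ →+ _) where
  map_add := map_add _
  map_mul := conjugation_mul hunit hcomm
  involutive := conjugation_conjugation hunit hcomm hα
  fixed_iff c := by
    rw [← ofField.commutes c, conjugation_ofField hunit, ofField_injective.eq_iff, hfix]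

end Conjugation

section Positivity

variable {k L : Type u} [Field k] [Field L] [Algebra k L] [FiniteDimensional k L] [IsGalois k L]
  {ξ : Gal(L/k) × Gal(L/k) → Lˣ} {hξ : IsTwoCocycle k L ξ} {α : L ≃+* L}

theorem reducedTrace_conjugation_mul_self (x : CrossedProduct k L ξ hξ) :
    reducedTrace k (CrossedProduct k L ξ hξ) (conjugation α x * x) =
      ∑ σ, Algebra.trace k L (α (x.coeff σ) * x.coeff σ) := by
  simp only [reducedTrace_eq, scalarPart_conjugation_mul_self, map_sum,
    Algebra.trace_eq_of_algEquiv]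

variable [Algebra k ℂ] [Algebra L ℂ] [IsScalarTower k L ℂ]

theorem isPositiveInvolution_conjugation
    (hα : ∀ z, algebraMap L ℂ (α z) = starRingEnd ℂ (algebraMap L ℂ z))
    (hcomm : ∀ (σ : Gal(L/k)) (z : L), α (σ z) = σ (α z)) :
    IsPositiveInvolution k (conjugation α : CrossedProduct k L ξ hξ →+ _) := by
  intro x hx
  have htrace : algebraMap k ℂ (reducedTrace k _ (conjugation α x * x)) =
      ((∑ σ : Gal(L/k), ∑ ρ : Gal(L/k),
        Complex.normSq (algebraMap L ℂ (ρ (x.coeff σ))) : ℝ) : ℂ) := by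
    rw [reducedTrace_conjugation_mul_self, map_sum, Complex.ofReal_sum]
    simp only [algebraMap_trace_mul_eq_sum_normSq hα hcomm]
  obtain ⟨σ, hσ⟩ : ∃ σ, x.coeff σ ≠ 0 := by
    by_contra! h
    exact hx (ext h)
  rw [htrace]
  refine ⟨Complex.ofReal_im _, Finset.sum_pos' (fun _ _ => Finset.sum_nonneg fun _ _ =>
    Complex.normSq_nonneg _) ⟨σ, Finset.mem_univ σ, Finset.sum_pos (fun ρ _ => ?_)
      Finset.univ_nonempty⟩⟩
  simpa using hσ

theorem apply_galois_comm_of_isPositiveInvolution (hk : DenseRange (algebraMap k ℂ))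
    (hαk : ∀ c, α (algebraMap k L c) ∈ Set.range (algebraMap k L))
    (hα : ∀ z, algebraMap L ℂ (α z) = starRingEnd ℂ (algebraMap L ℂ z))
    {τ : CrossedProduct k L ξ hξ → CrossedProduct k L ξ hξ} (hτ : IsPositiveInvolution k τ)
    (hτα : ∀ z, τ (ofField z) = ofField (α z)) (σ : Gal(L/k)) (z : L) : α (σ z) = σ (α z) := by
  refine apply_galois_comm_of_trace_nonneg hk hαk hα (fun y => ?_) σ z
  rcases eq_or_ne y 0 with rfl | hy
  · simp
  · have hpos := (hτ (ofField y) ((map_ne_zero_iff _ ofField_injective).mpr hy)).2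
    rw [hτα, ← map_mul, reducedTrace_eq, scalarPart_ofField] at hpos
    exact hpos.le

end Positivity

end CrossedProduct

end CrossedProd

open CrossedProd CrossedProduct in
theorem corollary3p2_general {k₀ : Type w} {k L : Type u} [Field k₀] [Field k] [Field L]
    [Algebra k₀ k] [Algebra k L] [Algebra k ℂ] [Algebra L ℂ] [IsScalarTower k L ℂ]
    [FiniteDimensional k L] [IsGalois k L]
    (hquad : Module.finrank k₀ k = 2) {ι : k ≃ₐ[k₀] k} (hι : ι ≠ 1)
    (hιconj : ∀ z, algebraMap k ℂ (ι z) = starRingEnd ℂ (algebraMap k ℂ z))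
    {α : L ≃+* L} (hα : ∀ z, algebraMap L ℂ (α z) = starRingEnd ℂ (algebraMap L ℂ z))
    {ξ : Gal(L/k) × Gal(L/k) → Lˣ} (hξ : IsTwoCocycle k L ξ)
    (hunit : ∀ σ ρ, α (ξ (σ, ρ) : L) * (ξ (σ, ρ) : L) = 1) :
    (∃ τ : CrossedProduct k L ξ hξ → CrossedProduct k L ξ hξ,
        IsUnitaryInvolution k₀ k τ ∧ IsPositiveInvolution k τ ∧
        ∀ z : L, τ (ofField z) = ofField (α z)) ↔
      ∀ (σ : Gal(L/k)) (z : L), α (σ z) = σ (α z) := by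
  have hαι (c : k) : α (algebraMap k L c) = algebraMap k L (ι c) :=
    (algebraMap L ℂ).injective <| by
      simp only [hα, ← IsScalarTower.algebraMap_apply k L ℂ, hιconj]
  constructor
  · rintro ⟨τ, -, hpos, hτ⟩
    obtain ⟨c, hc⟩ : ∃ c, ι c ≠ c := by simpa [AlgEquiv.ext_iff] using hι
    have him : (algebraMap k ℂ c).im ≠ 0 := fun him =>
      hc ((algebraMap k ℂ).injective ((hιconj c).trans (Complex.conj_eq_iff_im.mpr him)))
    exact apply_galois_comm_of_isPositiveInvolution (denseRange_algebraMap_complex him)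
      (fun c => ⟨ι c, (hαι c).symm⟩) hα hpos hτ
  · intro hcomm
    have hαα : Function.Involutive α := fun z =>
      (algebraMap L ℂ).injective (by rw [hα, hα, Complex.conj_conj])
    refine ⟨conjugation α, isUnitaryInvolution_conjugation hunit hcomm hαα fun c => ?_,
      isPositiveInvolution_conjugation hα hcomm, conjugation_ofField hunit⟩
    rw [hαι, (algebraMap k L).injective.eq_iff,
      algEquiv_apply_eq_self_iff (hquad ▸ Nat.prime_two) hι]

theorem corollary3p2
    -- `k/k₀` is a quadratic extension of number fields in `ℂ`, whose nontrivial automorphism `ι`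
    -- is complex conjugation
    (k₀ : Subfield ℂ) [NumberField k₀]
    (k : IntermediateField k₀ ℂ) (hquad : Module.finrank k₀ k = 2)
    (ι : k ≃ₐ[k₀] k) (hι : ι ≠ 1) (hιconj : ∀ z : k, (ι z : ℂ) = starRingEnd ℂ (z : ℂ))
    -- `L/k` is a finite Galois extension in `ℂ`, and complex conjugation induces `α` on `L`
    (L : IntermediateField k ℂ) [FiniteDimensional k L] [IsGalois k L]
    (α : L ≃+* L) (hα : ∀ z : L, (α z : ℂ) = starRingEnd ℂ (z : ℂ))
    -- `ξ` is a `2`-cocycle of unitary elements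
    (ξ : Gal(L/k) × Gal(L/k) → (↥L)ˣ) (hξ : CrossedProd.IsTwoCocycle k L ξ)
    (hunit : ∀ σ ρ : Gal(L/k), α (ξ (σ, ρ) : L) * (ξ (σ, ρ) : L) = 1)
    -- `B = (ξ, L/k, G)` is a division algebra
    (hdiv : ∀ x : CrossedProd.CrossedProduct k L ξ hξ, x ≠ 0 → IsUnit x) :
    (∃ τ : CrossedProd.CrossedProduct k L ξ hξ → CrossedProd.CrossedProduct k L ξ hξ,
        CrossedProd.IsUnitaryInvolution k₀ k τ ∧
        CrossedProd.IsPositiveInvolution k τ ∧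
        ∀ z : L, τ (CrossedProd.CrossedProduct.ofField z) =
          CrossedProd.CrossedProduct.ofField (α z)) ↔
      ∀ σ : Gal(L/k), ∀ z : L, α (σ z) = σ (α z) :=
  corollary3p2_general hquad hι hιconj hα hξ hunit
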